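/- Let $X,Y$ be Polish spaces with their Borel $\sigma$-fields and let $d\ge 1$. Let $\boldsymbol\mu=(\mu_1,\dots,\mu_d)$ and $\boldsymbol\nu=(\nu_1,\dots,\nu_d)$ be tuples of finite non-zero Borel measures on $X$ and on $Y$ respectively, with $\mu_j(X)=\nu_j(Y)$ for every $j$. Put $$\bar\mu=\frac{\sum_{j=1}^d\mu_j}{\sum_{j=1}^d\mu_j(X)},$$ and let $\eta$ be a Borel probability measure on $X$ with $\eta\ll\bar\mu$ and $\bar\mu\ll\eta$. Suppose that the Radon–Nikodym derivatives $\frac{\mathrm d\boldsymbol\mu}{\mathrm d\eta}=\bigl(\frac{\mathrm d\mu_1}{\mathrm d\eta},\dots,\frac{\mathrm d\mu_d}{\mathrm d\eta}\bigr)$ and $\frac{\mathrm d\eta}{\mathrm d\bar\mu}$ have bounded continuous versions with values in $[0,\infty)$, and fix such versions. Let $c:X\times Y\to[0,\infty]$ be lower semicontinuous. Let $\Pi_\eta(\boldsymbol\mu,\boldsymbol\nu)$ be the set of all probability measures $\eta\otimes\kappa$ on $X\times Y$, where $(\eta\otimes\kappa)(\mathrm dx,\mathrm dy)=\eta(\mathrm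 dx)\,\kappa(x;\mathrm dy)$ and $\kappa$ runs over the stochastic kernels from $X$ to $Y$ such that $\int_X\kappa(x;B)\,\mu_j(\mathrm dx)\ge\nu_j(B)$ for all $j$ and all Borel $B\subseteq Y$. Let $\Phi_c$ be the set of all pairs $(\phi,\boldsymbol\psi)$ of continuous functions $\phi:X\to\mathbb R$ and $\boldsymbol\psi=(\psi_1,\dots,\psi_d):Y\to\mathbb R^d$ such that $\phi\in L^1(\eta)$, $\psi_j\in L^1(\nu_j)$ for every $j$, and $$\phi(x)+\boldsymbol\psi(y)\cdot\frac{\mathrm d\boldsymbol\mu}{\mathrm d\eta}(x)\le c(x,y)\qquad\text{for all }x\in X,\ y\in Y.$$ Then, as elements of $[0,\infty]$ and with $\inf\emptyset=\infty$, $$\inf_{\pi\in\Pi_\eta(\boldsymbol\mu,\boldsymbol\nu)}\int_{X\times Y}c\,\mathrm d\pi=\sup_{(\phi,\boldsymbol\psi)\in\Phi_c}\left(\int_X\phi\,\mathrm d\eta+\sum_{j=1}^d\int_Y\psi_j\,\mathrm d\nu_j\right).$$ Moreover, if $\Pi_\eta(\boldsymbol\mu,\boldsymbol\nu)$ is non-empty,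 then the infimum is attained by some $\pi\in\Pi_\eta(\boldsymbol\mu,\boldsymbol\nu)$. -/

import Mathlib

open MeasureTheory ProbabilityTheory
open scoped NNReal ENNReal BoundedContinuousFunction

noncomputable section

/-- The normalized average `(∑ⱼ μⱼ) / (∑ⱼ μⱼ(X))` of a tuple of measures. -/
def averageMeasure {X : Type*} [MeasurableSpace X] {d : ℕ} (μ : Fin d → Measure X) : Measure X :=
  (∑ j, μ j Set.univ)⁻¹ • ∑ j, μ j

/-- `κ` is a simultaneous transport kernel from `μ` to `ν`: a stochastic kernel such that
`∫ κ(x; ·) μⱼ(dx) ≥ νⱼ` for every `j`. -/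
structure IsTransportKernel {X Y : Type*} [MeasurableSpace X] [MeasurableSpace Y] {d : ℕ}
    (μ : Fin d → Measure X) (ν : Fin d → Measure Y) (κ : Kernel X Y) : Prop where
  isMarkov : IsMarkovKernel κ
  covers : ∀ j, ν j ≤ (μ j).bind κ

/-- The set `Π_η(μ, ν)` of simultaneous transport plans `η ⊗ κ`, where `κ` ranges over the
simultaneous transport kernels from `μ` to `ν`. -/
def transportPlans {X Y : Type*} [MeasurableSpace X] [MeasurableSpace Y] {d : ℕ}
    (η : Measure X) (μ : Fin d → Measure X) (ν : Fin d → Measure Y) : Set (Measure (X × Y)) :=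
  {π | ∃ κ : Kernel X Y, IsTransportKernel μ ν κ ∧ π = η.compProd κ}

/-- The set `Φ_c` of dual feasible pairs of continuous functions `(φ, ψ)`, with
`φ(x) + ψ(y) · f(x) ≤ c(x, y)` everywhere, for which the dual objective is defined
(`φ` is `η`-integrable and `ψⱼ` is `νⱼ`-integrable). Here `f` is the density `dμ/dη`. -/
def dualFeasible {X Y : Type*} [TopologicalSpace X] [MeasurableSpace X]
    [TopologicalSpace Y] [MeasurableSpace Y] {d : ℕ}
    (η : Measure X) (ν : Fin d → Measure Y) (f : Fin d → X → ℝ≥0) (c : X × Y → ℝ≥0∞) :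
    Set (C(X, ℝ) × (Fin d → C(Y, ℝ))) :=
  {p | Integrable p.1 η ∧ (∀ j, Integrable (p.2 j) (ν j)) ∧
    ∀ x y, ((p.1 x + ∑ j, p.2 j y * (f j x : ℝ) : ℝ) : EReal) ≤ (c (x, y) : EReal)}

/-- The dual objective `∫ φ dη + ∫ ψᵀ dν`. -/
def dualValue {X Y : Type*} [TopologicalSpace X] [MeasurableSpace X]
    [TopologicalSpace Y] [MeasurableSpace Y] {d : ℕ}
    (η : Measure X) (ν : Fin d → Measure Y) (p : C(X, ℝ) × (Fin d → C(Y, ℝ))) : ℝ :=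
  ∫ x, p.1 x ∂η + ∑ j, ∫ y, p.2 j y ∂(ν j)

end

/-! Weak duality (`HasWeightedMarginals.dualValue_le`) is integration of the dual constraint. Since
the masses balance, the covering inequalities are equalities, so a plan is a measure `π` with first
marginal `η` such that `f j · π` has second marginal `ν j`.

For the converse, suppose the dual values are bounded by `T`. Embed `X` and `Y` in compact
metrizable spaces, the one for `X` chosen so that the densities `f j` extend. The dual objective,
with an extra coordinate of value `T` standing for `c`, is positive along the cone of pairs `(u, s)`
with `u + s c ≥ 0`; Riesz extension and Riesz–Markov–Kakutani represent it by a measure `ρ`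
(`exists_finiteMeasure_of_dual_bound`). The marginals force `ρ` to live on the image of `X × Y`,
because almost everywhere some `f j` is nonzero (`exists_hasWeightedMarginals_map_eq`).
Approximating `c` from below by extendable functions gives cost at most `T`. With `T` the dual
supremum, this plan closes the gap and is optimal. -/

/-! ### Extension and representation of positive functionals -/

/-- A form of the M. Riesz extension theorem for functionals given through a linear map `g`. -/
theorem exists_positive_extension_along {V E : Type*} [AddCommGroup V] [Module ℝ V]
    [AddCommGroup E] [Module ℝ E] (s : PointedCone ℝ E) (g : V →ₗ[ℝ] E) (l : V →ₗ[ℝ] ℝ)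
    (nonneg : ∀ v, g v ∈ s → 0 ≤ l v) (dense : ∀ y, ∃ v, g v + y ∈ s) :
    ∃ L : E →ₗ[ℝ] ℝ, (∀ v, L (g v) = l v) ∧ ∀ x ∈ s, 0 ≤ L x := by
  -- As `g` may fail to be injective, `l` need not be visibly defined on its range; extending from
  -- `0 × V` inside `E × V` avoids this.
  let s' : PointedCone ℝ (E × V) := s.comap ((LinearMap.id (R := ℝ) (M := E)).coprod g)
  have hs' : ∀ p : E × V, p ∈ s' ↔ p.1 + g p.2 ∈ s := fun p => by
    simp [s', PointedCone.mem_comap]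
  let D : Submodule ℝ (E × V) := Submodule.prod ⊥ ⊤
  let f : E × V →ₗ.[ℝ] ℝ := ⟨D, (l.comp (LinearMap.snd ℝ E V)).comp D.subtype⟩
  have hD : ∀ v : V, ((0, v) : E × V) ∈ f.domain := fun v => by simp [f, D]
  obtain ⟨G, hG, hpos⟩ := riesz_extension s' f (by
      rintro ⟨⟨e, v⟩, hx⟩ h
      have he : e = 0 := by simpa [f, D] using hx
      subst he
      rw [hs'] at h
      exact nonneg v (by simpa using h)) (by
      rintro ⟨e, v⟩
      obtain ⟨w, hw⟩ := dense e
      refine ⟨⟨(0, w - v), hD _⟩, ?_⟩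
      rw [hs']
      simpa [add_comm] using hw)
  have hGv : ∀ v, G (0, v) = l v := fun v => hG ⟨(0, v), hD v⟩
  -- Both `(g v, -v)` and its negative are sent to `0`, hence lie in `s'`.
  have hzero : ∀ v, G (g v, -v) = 0 := fun v => by
    have h1 := hpos (g v, -v) (by rw [hs']; simp)
    have h2 := hpos (-(g v, -v)) (by rw [hs']; simp)
    rw [map_neg] at h2
    linarith
  refine ⟨G.comp (LinearMap.inl ℝ E V), fun v => ?_,
    fun x hx => hpos _ (by rw [hs']; simpa using hx)⟩
  have h3 : ((g v, 0) : E × V) = (g v, -v) + (0, v) := by simp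
  simp only [LinearMap.comp_apply, LinearMap.inl_apply]
  rw [h3, map_add, hzero, hGv, zero_add]

/-- A positive linear functional on `C(K, ℝ)`, `K` compact, is integration against a measure. -/
theorem exists_measure_of_positive {K : Type*} [TopologicalSpace K] [T2Space K] [CompactSpace K]
    [MeasurableSpace K] [BorelSpace K] (L : C(K, ℝ) →ₗ[ℝ] ℝ)
    (hL : ∀ u : C(K, ℝ), (∀ x, 0 ≤ u x) → 0 ≤ L u) :
    ∃ ρ : Measure K, IsFiniteMeasure ρ ∧ ∀ u : C(K, ℝ), ∫ x, u x ∂ρ = L u := by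
  let A : CompactlySupportedContinuousMap K ℝ →ₚ[ℝ] ℝ := PositiveLinearMap.mk₀
    { toFun := fun u => L u.toContinuousMap
      map_add' := fun u v => L.map_add u.toContinuousMap v.toContinuousMap
      map_smul' := fun a u => L.map_smul a u.toContinuousMap }
    (fun u hu => hL _ hu)
  exact ⟨RealRMK.rieszMeasure A, inferInstance, fun u =>
    RealRMK.integral_rieszMeasure A ⟨u, HasCompactSupport.of_compactSpace _⟩⟩

/-! ### Lower semicontinuous costs and the cost cone -/

/-- A lower semicontinuous function on a space embedded in a compact metrizable space `K` is the
increasing limit of functions that extend continuously to `K`. -/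
theorem LowerSemicontinuous.exists_monotone_extendable {Z K : Type*} [TopologicalSpace Z]
    [Nonempty Z] [TopologicalSpace K] [TopologicalSpace.MetrizableSpace K] {e : Z → K}
    (he : Topology.IsInducing e) {c : Z → ℝ≥0∞} (hc : LowerSemicontinuous c) :
    ∃ h : ℕ → C(K, ℝ≥0), Monotone h ∧ ∀ z, ⨆ n, (h n (e z) : ℝ≥0∞) = c z := by
  let _ := TopologicalSpace.metrizableSpaceMetric K
  -- Inf-convolution with `n * edist`: it is `n`-Lipschitz, and truncating `c` at `n` keeps it
  -- finite.
  let F : ℕ → K → ℝ≥0∞ := fun n k => ⨅ w, (min (c w) n + n * edist k (e w))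
  have hFtop : ∀ n k, F n k ≠ ⊤ := fun n k => by
    obtain ⟨w⟩ := ‹Nonempty Z›
    refine ne_top_of_le_ne_top ?_ (iInf_le _ w)
    exact ENNReal.add_ne_top.2 ⟨ne_top_of_le_ne_top (ENNReal.natCast_ne_top n) (min_le_right _ _),
      ENNReal.mul_ne_top (ENNReal.natCast_ne_top n) (edist_ne_top _ _)⟩
  have hFcont : ∀ n, Continuous (F n) := fun n => by
    refine continuous_of_le_add_edist n (ENNReal.natCast_ne_top n) fun x y => ?_
    rw [ENNReal.iInf_add]
    refine le_iInf fun w => (iInf_le _ w).trans ?_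
    rw [add_assoc, ← mul_add]
    gcongr
    rw [add_comm]
    exact edist_triangle _ _ _
  refine ⟨fun n => ⟨fun k => (F n k).toNNReal, ?_⟩, ?_, fun z => ?_⟩
  · exact continuous_iff_continuousAt.2 fun k =>
      (ENNReal.tendsto_toNNReal (hFtop n k)).comp (hFcont n).continuousAt
  · intro m n hmn k
    refine ENNReal.toNNReal_mono (hFtop n k) (iInf_mono fun w => ?_)
    have : (m : ℝ≥0∞) ≤ n := by exact_mod_cast hmn
    gcongr
  simp only [ContinuousMap.coe_mk, ENNReal.coe_toNNReal (hFtop _ _)]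
  refine le_antisymm (iSup_le fun n => (iInf_le _ z).trans ?_) (le_of_forall_lt fun a ha => ?_)
  · simp
  obtain ⟨b, hab, hb⟩ := exists_between ha
  refine hab.trans_le ?_
  have hbtop : b ≠ ⊤ := hb.ne_top
  have hnhds := hc z b hb
  rw [he.nhds_eq_comap, Filter.eventually_comap] at hnhds
  obtain ⟨ε, hε, hball⟩ := EMetric.mem_nhds_iff.1 hnhds
  obtain ⟨n₁, hn₁⟩ := ENNReal.exists_nat_gt hbtop
  obtain ⟨n₂, hn₂⟩ := ENNReal.exists_nat_gt (ENNReal.div_ne_top hbtop hε.ne')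
  have h1 : (n₁ : ℝ≥0∞) ≤ (max n₁ n₂ : ℕ) := by exact_mod_cast le_max_left _ _
  have h2 : (n₂ : ℝ≥0∞) ≤ (max n₁ n₂ : ℕ) := by exact_mod_cast le_max_right _ _
  -- Within `ε` of `e z`, semicontinuity and `n₁ > b` suffice; farther away the penalty does, as `n₂
  -- * ε ≥ b`.
  refine le_iSup_of_le (max n₁ n₂) (le_iInf fun w => ?_)
  by_cases hw : edist (e w) (e z) < ε
  · exact le_add_right (le_min (hball hw w rfl).le (hn₁.le.trans h1))
  · refine le_add_left ?_
    have h3 : ε ≤ edist (e z) (e w) := by rw [edist_comm]; exact not_lt.1 hw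
    have h4 := (ENNReal.div_le_iff_le_mul (Or.inl hε.ne')
      (Or.inr (pos_of_gt (hn₂.trans_le h2)).ne')).1 (hn₂.le.trans h2)
    exact h4.trans (by gcongr)

theorem EReal.coe_le_coe_ennreal_iff {a : ℝ} {c : ℝ≥0∞} :
    (a : EReal) ≤ (c : EReal) ↔ ENNReal.ofReal a ≤ c := by
  induction c with
  | top => simp
  | coe r =>
    rw [EReal.coe_nnreal_eq_coe_real, EReal.coe_le_coe_iff]
    simp [ENNReal.ofReal_le_iff_le_toReal]

/-- The cone of pairs `(u, s)` with `0 ≤ s` and `0 ≤ u ∘ e + s c`. -/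
def costCone {Z K : Type*} [TopologicalSpace K] (e : Z → K) (c : Z → ℝ≥0∞) :
    PointedCone ℝ (C(K, ℝ) × ℝ) where
  -- Since `0 * ∞ = 0`, at `s = 0` this demands `u ≥ 0` on the image even where `c = ∞`.
  carrier := {p | 0 ≤ p.2 ∧ ∀ z, ENNReal.ofReal (-p.1 (e z)) ≤ ENNReal.ofReal p.2 * c z}
  zero_mem' := by simp
  add_mem' := by
    rintro p q ⟨hp, hp'⟩ ⟨hq, hq'⟩
    refine ⟨add_nonneg hp hq, fun z => ?_⟩
    have h : -(p + q).1 (e z) = -p.1 (e z) + -q.1 (e z) := by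
      simp only [Prod.fst_add, ContinuousMap.add_apply]; ring
    rw [h, Prod.snd_add, ENNReal.ofReal_add hp hq, add_mul]
    exact ENNReal.ofReal_add_le.trans (add_le_add (hp' z) (hq' z))
  smul_mem' := by
    rintro ⟨a, ha⟩ p ⟨hp, hp'⟩
    refine ⟨mul_nonneg ha hp, fun z => ?_⟩
    have h : -((⟨a, ha⟩ : {r : ℝ // 0 ≤ r}) • p).1 (e z) = a * -p.1 (e z) := by
      change -(a * p.1 (e z)) = _
      ring
    have h' : ((⟨a, ha⟩ : {r : ℝ // 0 ≤ r}) • p).2 = a * p.2 := rfl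
    rw [h, h', ENNReal.ofReal_mul ha, ENNReal.ofReal_mul ha, mul_assoc]
    exact mul_le_mul_right (hp' z) _

/-! ### The dual bound on a compact product -/

section compact

variable {A B : Type*} [TopologicalSpace A] [TopologicalSpace B] {d : ℕ}

/-- The potential `(x, y) ↦ φ x + ∑ j, ψ j y * f j x`. -/
def potential (f : Fin d → C(A, ℝ≥0)) :
    C(A, ℝ) × (Fin d → C(B, ℝ)) →ₗ[ℝ] C(A × B, ℝ) where
  toFun p := ⟨fun z => p.1 z.1 + ∑ j, p.2 j z.2 * (f j z.1 : ℝ), by fun_prop⟩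
  map_add' p q := by
    ext z
    simp [add_mul, Finset.sum_add_distrib]
    ring
  map_smul' a p := by
    ext z
    simp [Finset.mul_sum, mul_add, mul_assoc]

theorem potential_apply (f : Fin d → C(A, ℝ≥0)) (p : C(A, ℝ) × (Fin d → C(B, ℝ))) (z : A × B) :
    potential f p z = p.1 z.1 + ∑ j, p.2 j z.2 * (f j z.1 : ℝ) := rfl

/-- Integration of a continuous function on a compact space along a measurable map, as a
linear functional. -/
noncomputable def integralAlong {X : Type*} [MeasurableSpace X] [CompactSpace A] [MeasurableSpace A]
    [BorelSpace A] {e : X → A} (he : Measurable e) (η : Measure X) [IsFiniteMeasure η] :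
    C(A, ℝ) →ₗ[ℝ] ℝ where
  toFun φ := ∫ x, φ (e x) ∂η
  map_add' φ φ' := integral_add
    (Integrable.of_bound (φ.continuous.measurable.comp he).aestronglyMeasurable ‖φ‖
      (.of_forall fun x => φ.norm_coe_le_norm (e x)))
    (Integrable.of_bound (φ'.continuous.measurable.comp he).aestronglyMeasurable ‖φ'‖
      (.of_forall fun x => φ'.norm_coe_le_norm (e x)))
  map_smul' a _ := integral_smul a _

theorem integralAlong_apply {X : Type*} [MeasurableSpace X] [CompactSpace A] [MeasurableSpace A]
    [BorelSpace A] {e : X → A} (he : Measurable e) (η : Measure X) [IsFiniteMeasure η]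
    (φ : C(A, ℝ)) : integralAlong he η φ = ∫ x, φ (e x) ∂η := rfl

theorem exists_finiteMeasure_of_dual_bound {X Y : Type*} [MeasurableSpace X] [MeasurableSpace Y]
    [CompactSpace A] [T2Space A] [SecondCountableTopology A] [MeasurableSpace A] [BorelSpace A]
    [CompactSpace B] [T2Space B] [SecondCountableTopology B] [MeasurableSpace B] [BorelSpace B]
    {a : X → A} {b : Y → B} (ha : Measurable a) (hb : Measurable b)
    (η : Measure X) [IsFiniteMeasure η] (ν : Fin d → Measure Y) [∀ j, IsFiniteMeasure (ν j)]
    (f : Fin d → C(A, ℝ≥0)) (c : X × Y → ℝ≥0∞) (T : ℝ)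
    (hT : ∀ p : C(A, ℝ) × (Fin d → C(B, ℝ)),
      (∀ x y, ENNReal.ofReal (potential f p (a x, b y)) ≤ c (x, y)) →
      ∫ x, p.1 (a x) ∂η + ∑ j, ∫ y, p.2 j (b y) ∂(ν j) ≤ T) :
    ∃ ρ : Measure (A × B), IsFiniteMeasure ρ ∧
      (∀ φ : C(A, ℝ), ∫ z, φ z.1 ∂ρ = ∫ x, φ (a x) ∂η) ∧
      (∀ j (ψ : C(B, ℝ)), ∫ z, (f j z.1 : ℝ) * ψ z.2 ∂ρ = ∫ y, ψ (b y) ∂(ν j)) ∧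
      ∀ u : C(A × B, ℝ), (∀ x y, ENNReal.ofReal (u (a x, b y)) ≤ c (x, y)) → ∫ z, u z ∂ρ ≤ T := by
  let l₀ : C(A, ℝ) × (Fin d → C(B, ℝ)) →ₗ[ℝ] ℝ :=
    (integralAlong ha η).coprod (LinearMap.lsum ℝ _ ℝ fun j => integralAlong hb (ν j))
  have hl₀ : ∀ p, l₀ p = ∫ x, p.1 (a x) ∂η + ∑ j, ∫ y, p.2 j (b y) ∂(ν j) := fun p => by
    simp [l₀, integralAlong_apply]
  let g : (C(A, ℝ) × (Fin d → C(B, ℝ))) × ℝ →ₗ[ℝ] C(A × B, ℝ) × ℝ :=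
    (potential f).prodMap LinearMap.id
  let l : (C(A, ℝ) × (Fin d → C(B, ℝ))) × ℝ →ₗ[ℝ] ℝ := l₀.coprod (T • LinearMap.id)
  let S := costCone (Prod.map a b) c
  obtain ⟨L, hLg, hLS⟩ := exists_positive_extension_along S g l (by
    rintro ⟨p, t⟩ ⟨ht, hp⟩
    have hp' : ∀ z : X × Y, ENNReal.ofReal (-potential f p (a z.1, b z.2)) ≤
      ENNReal.ofReal t * c z := hp
    change 0 ≤ l₀ p + T * t
    -- The potential `-r • p` is dual feasible once `r * t ≤ 1`. For `t > 0` take `r = t⁻¹`; for `t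
    -- = 0` every `r ≥ 0` is allowed, and `r = (T + 1) / -l₀ p` would exceed the bound.
    have key : ∀ r : ℝ, 0 ≤ r → r * t ≤ 1 → -(r * l₀ p) ≤ T := fun r hr hrt => by
      rw [← smul_eq_mul, ← map_smul, ← map_neg, hl₀]
      refine hT _ fun x y => ?_
      rw [map_neg, map_smul, ContinuousMap.neg_apply, ContinuousMap.smul_apply, smul_eq_mul,
        ← mul_neg, ENNReal.ofReal_mul hr]
      refine (mul_le_mul_right (hp' (x, y)) _).trans ?_
      rw [← mul_assoc, ← ENNReal.ofReal_mul hr]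
      exact mul_le_of_le_one_left' (by simpa using hrt)
    rcases (show (0 : ℝ) ≤ t from ht).eq_or_lt with rfl | ht
    · rw [mul_zero, add_zero]
      by_contra! hneg
      have hT0 : 0 ≤ T := by simpa using key 0 le_rfl (by simp)
      have h := key ((T + 1) / -l₀ p) (div_nonneg (by linarith) (by linarith)) (by simp)
      rw [div_mul_eq_mul_div, div_neg, neg_neg, mul_div_cancel_right₀ _ hneg.ne] at h
      linarith
    · have h := key t⁻¹ (by positivity) (by rw [inv_mul_cancel₀ ht.ne'])
      have h2 := mul_le_mul_of_nonneg_right h ht.le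
      have h3 : -(t⁻¹ * l₀ p) * t = -l₀ p := by field_simp
      linarith) (by
    rintro ⟨u, s⟩
    -- The constant `‖u‖` is a potential dominating `-u`, and `-s` cancels the cost coordinate.
    refine ⟨((ContinuousMap.const A ‖u‖, 0), -s), ?_, fun z => ?_⟩
    · simp [g]
    · have h : -(‖u‖ + u (Prod.map a b z)) ≤ 0 := by
        have := (abs_le.1 (u.norm_coe_le_norm (Prod.map a b z))).1
        linarith
      have h' : (g ((ContinuousMap.const A ‖u‖, 0), -s) + (u, s)).1 (Prod.map a b z) =
          ‖u‖ + u (Prod.map a b z) := by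
        simp [g, potential_apply]
      rw [h', ENNReal.ofReal_of_nonpos h]
      exact zero_le)
  have hpot : ∀ p, L (potential f p, 0) = l₀ p := fun p => by
    have := hLg (p, 0)
    simpa [g, l] using this
  have hone : L (0, 1) = T := by
    have := hLg (0, 1)
    simpa [g, l] using this
  obtain ⟨ρ, hρ, hρL⟩ := exists_measure_of_positive (L.comp (LinearMap.inl ℝ C(A × B, ℝ) ℝ))
    (fun u hu => hLS _ ⟨le_rfl, fun z => by
      rw [ENNReal.ofReal_of_nonpos (by simpa using hu _)]; exact zero_le⟩)
  simp only [LinearMap.comp_apply, LinearMap.inl_apply] at hρL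
  refine ⟨ρ, hρ, fun φ => ?_, fun j ψ => ?_, fun u hu => ?_⟩
  · have := (hρL (potential f (φ, 0))).trans (hpot _)
    rw [hl₀] at this
    simpa [potential_apply] using this
  · have := (hρL (potential f (0, Pi.single j ψ))).trans (hpot _)
    rw [hl₀] at this
    have h1 : ∀ z : A × B, ∑ i, (Pi.single j ψ : Fin d → C(B, ℝ)) i z.2 * (f i z.1 : ℝ) =
        (f j z.1 : ℝ) * ψ z.2 := fun z => by
      rw [Finset.sum_eq_single j (fun i _ hi => by simp [Pi.single_eq_of_ne hi]) (by simp),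
        Pi.single_eq_same, mul_comm]
    have h2 : ∑ i, ∫ y, (Pi.single j ψ : Fin d → C(B, ℝ)) i (b y) ∂(ν i) =
        ∫ y, ψ (b y) ∂(ν j) := by
      rw [Finset.sum_eq_single j (fun i _ hi => by simp [Pi.single_eq_of_ne hi]) (by simp),
        Pi.single_eq_same]
    simpa [potential_apply, h1, h2] using this
  -- `u ≤ c` says that `(-u, 1)` is in the cone, and `L (0, 1) = T`.
  · have h : 0 ≤ L (-u, 1) := hLS _ ⟨zero_le_one, fun z => by
      simpa [Prod.map] using hu z.1 z.2⟩
    have h2 : ((-u, 1) : C(A × B, ℝ) × ℝ) = (0, 1) - (u, 0) := by simp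
    rw [h2, map_sub, hone, ← hρL] at h
    linarith

end compact

/-! ### Transport plans as measures with weighted marginals -/

theorem MeasureTheory.Measure.map_withDensity_comp {α β : Type*} [MeasurableSpace α]
    [MeasurableSpace β] (μ : Measure α) {e : α → β} (he : Measurable e) {g : β → ℝ≥0∞}
    (hg : Measurable g) : (μ.withDensity fun x => g (e x)).map e = (μ.map e).withDensity g := by
  ext s hs
  rw [Measure.map_apply he hs, withDensity_apply _ (he hs), withDensity_apply _ hs,
    setLIntegral_map hs hg he]

theorem MeasureTheory.Measure.snd_withDensity_compProd {X Y : Type*} [MeasurableSpace X]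
    [MeasurableSpace Y] (η : Measure X) [SFinite η] (κ : Kernel X Y) [IsSFiniteKernel κ]
    {g : X → ℝ≥0∞} (hg : Measurable g) :
    ((η.compProd κ).withDensity fun z => g z.1).snd = (η.withDensity g).bind κ := by
  ext s hs
  rw [Measure.snd_apply hs, withDensity_apply _ (measurable_snd hs),
    Measure.bind_apply hs κ.measurable.aemeasurable,
    lintegral_withDensity_eq_lintegral_mul _ hg (κ.measurable_coe hs),
    ← lintegral_indicator (measurable_snd hs),
    Measure.lintegral_compProd (f := (Prod.snd ⁻¹' s).indicator fun z => g z.1)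
      ((hg.comp measurable_fst).indicator (measurable_snd hs))]
  refine lintegral_congr fun x => ?_
  have : ∀ y, (Prod.snd ⁻¹' s).indicator (fun z : X × Y => g z.1) (x, y) =
      s.indicator (fun _ => g x) y := fun y => rfl
  simp only [this]
  rw [lintegral_indicator_const hs]
  rfl

/-- `π` has first marginal `η`, and the second marginal of `f j · π` is `ν j` for every `j`. -/
structure HasWeightedMarginals {X Y : Type*} [MeasurableSpace X] [MeasurableSpace Y] {d : ℕ}
    (η : Measure X) (ν : Fin d → Measure Y) (f : Fin d → X → ℝ≥0) (π : Measure (X × Y)) :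
    Prop where
  fst_eq : π.fst = η
  snd_eq : ∀ j, (π.withDensity fun z => f j z.1).snd = ν j

section

variable {X Y : Type*} [MeasurableSpace X] [MeasurableSpace Y] {d : ℕ}
  {η : Measure X} {μ : Fin d → Measure X} {ν : Fin d → Measure Y}
  {f : Fin d → X → ℝ≥0} {π : Measure (X × Y)}

theorem HasWeightedMarginals.isProbabilityMeasure [IsProbabilityMeasure η]
    (h : HasWeightedMarginals η ν f π) :
    IsProbabilityMeasure π :=
  ⟨by rw [← Measure.fst_univ, h.fst_eq, measure_univ]⟩

theorem hasWeightedMarginals_of_mem_transportPlans [IsProbabilityMeasure η]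
    [∀ j, IsFiniteMeasure (ν j)]
    (hbal : ∀ j, μ j Set.univ = ν j Set.univ) (hf : ∀ j, Measurable (f j))
    (hμ : ∀ j, μ j = η.withDensity fun x => f j x) (h : π ∈ transportPlans η μ ν) :
    HasWeightedMarginals η ν f π := by
  obtain ⟨κ, ⟨_, hκ⟩, rfl⟩ := h
  refine ⟨Measure.fst_compProd _ _, fun j => ?_⟩
  rw [Measure.snd_withDensity_compProd η κ (hf j).coe_nnreal_ennreal, ← hμ j]
  -- A Markov kernel preserves mass, so domination between finite measures of equal mass is
  -- equality.
  refine (Measure.eq_of_le_of_measure_univ_eq (hκ j) ?_).symm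
  rw [Measure.bind_apply .univ κ.measurable.aemeasurable]
  simp [hbal j]

theorem HasWeightedMarginals.mem_transportPlans [IsProbabilityMeasure η]
    [StandardBorelSpace Y] [Nonempty Y]
    (h : HasWeightedMarginals η ν f π) (hf : ∀ j, Measurable (f j))
    (hμ : ∀ j, μ j = η.withDensity fun x => f j x) : π ∈ transportPlans η μ ν := by
  have := h.isProbabilityMeasure
  have hdis : η.compProd π.condKernel = π := by
    conv_rhs => rw [← π.disintegrate π.condKernel, h.fst_eq]
  refine ⟨π.condKernel, ⟨inferInstance, fun j => ?_⟩, hdis.symm⟩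
  rw [hμ j, ← Measure.snd_withDensity_compProd η _ (hf j).coe_nnreal_ennreal, hdis, h.snd_eq]

theorem HasWeightedMarginals.integrable_fst (h : HasWeightedMarginals η ν f π) {φ : X → ℝ}
    (hφ : Integrable φ η) : Integrable (fun z => φ z.1) π :=
  (show Integrable φ π.fst from h.fst_eq.symm ▸ hφ).comp_measurable measurable_fst

theorem HasWeightedMarginals.integral_fst (h : HasWeightedMarginals η ν f π) {φ : X → ℝ}
    (hφ : Integrable φ η) : ∫ z, φ z.1 ∂π = ∫ x, φ x ∂η := by
  rw [← h.fst_eq] at hφ ⊢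
  exact (integral_map measurable_fst.aemeasurable hφ.aestronglyMeasurable).symm

theorem HasWeightedMarginals.integrable_snd (h : HasWeightedMarginals η ν f π)
    (hf : ∀ j, Measurable (f j)) (j : Fin d) {ψ : Y → ℝ} (hψ : Integrable ψ (ν j)) :
    Integrable (fun z => ψ z.2 * (f j z.1 : ℝ)) π := by
  rw [← h.snd_eq j] at hψ
  have := (integrable_withDensity_iff_integrable_smul ((hf j).comp measurable_fst)).1
    (hψ.comp_measurable measurable_snd)
  simpa [NNReal.smul_def, mul_comm] using this

theorem HasWeightedMarginals.integral_snd (h : HasWeightedMarginals η ν f π)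
    (hf : ∀ j, Measurable (f j)) (j : Fin d) {ψ : Y → ℝ} (hψ : Integrable ψ (ν j)) :
    ∫ z, ψ z.2 * (f j z.1 : ℝ) ∂π = ∫ y, ψ y ∂(ν j) := by
  rw [← h.snd_eq j] at hψ ⊢
  rw [Measure.snd, integral_map measurable_snd.aemeasurable hψ.aestronglyMeasurable]
  have := integral_withDensity_eq_integral_smul (μ := π) ((hf j).comp measurable_fst)
    (fun z => ψ z.2)
  simpa [NNReal.smul_def, mul_comm] using this.symm

end

/-! ### Weak duality -/

section

variable {X Y : Type*} [TopologicalSpace X] [MeasurableSpace X] [TopologicalSpace Y]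
  [MeasurableSpace Y] {d : ℕ}
  {η : Measure X} {ν : Fin d → Measure Y}
  {f : Fin d → X → ℝ≥0} {π : Measure (X × Y)}

/-- Weak duality. -/
theorem HasWeightedMarginals.dualValue_le (h : HasWeightedMarginals η ν f π)
    (hf : ∀ j, Measurable (f j)) {c : X × Y → ℝ≥0∞} (hc : AEMeasurable c π)
    {p : C(X, ℝ) × (Fin d → C(Y, ℝ))} (hp : p ∈ dualFeasible η ν f c) :
    (dualValue η ν p : EReal) ≤ ((∫⁻ z, c z ∂π : ℝ≥0∞) : EReal) := by
  by_cases hfin : ∫⁻ z, c z ∂π = ⊤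
  · simp [hfin]
  obtain ⟨hφ, hψ, hle⟩ := hp
  have hint : ∀ j, Integrable (fun z : X × Y => p.2 j z.2 * (f j z.1 : ℝ)) π :=
    fun j => h.integrable_snd hf j (hψ j)
  have hsum := integrable_finsetSum Finset.univ fun j _ => hint j
  have heq : dualValue η ν p = ∫ z, (p.1 z.1 + ∑ j, p.2 j z.2 * (f j z.1 : ℝ)) ∂π := by
    rw [integral_add (h.integrable_fst hφ) hsum, integral_finsetSum _ fun j _ => hint j,
      h.integral_fst hφ, dualValue]
    simp only [fun j => h.integral_snd hf j (hψ j)]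
  have hcint : Integrable (fun z => (c z).toReal) π := integrable_toReal_of_lintegral_ne_top hc hfin
  rw [← EReal.coe_ennreal_toReal hfin, EReal.coe_le_coe_iff,
    ← integral_toReal hc (ae_lt_top' hc hfin), heq]
  refine integral_mono_ae ((h.integrable_fst hφ).add hsum) hcint ?_
  filter_upwards [ae_lt_top' hc hfin] with z hz
  have := hle z.1 z.2
  rwa [← EReal.coe_ennreal_toReal hz.ne, EReal.coe_le_coe_iff] at this

end

/-! ### Densities with respect to `η` -/

section

variable {X : Type*} [MeasurableSpace X] {d : ℕ} {μ : Fin d → Measure X}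
  [∀ j, IsFiniteMeasure (μ j)] {η : Measure X}
  {f : Fin d → X → ℝ≥0}

theorem averageMeasure_eq_zero_iff {s : Set X} : averageMeasure μ s = 0 ↔ ∀ j, μ j s = 0 := by
  have h : (∑ j, μ j Set.univ)⁻¹ ≠ 0 :=
    ENNReal.inv_ne_zero.2 (ENNReal.sum_ne_top.2 fun j _ => measure_ne_top _ _)
  simp [averageMeasure, h, Measure.finsetSum_apply, Finset.sum_eq_zero_iff]

theorem eq_withDensity_of_averageMeasure_ac [IsProbabilityMeasure η] (hμη : averageMeasure μ ≪ η)
    (hf : ∀ j, (μ j).rnDeriv η =ᵐ[η] fun x => (f j x : ℝ≥0∞)) (j : Fin d) :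
    μ j = η.withDensity fun x => f j x := by
  have hac : μ j ≪ η := (Measure.AbsolutelyContinuous.mk fun s _ hs =>
    averageMeasure_eq_zero_iff.1 hs j).trans hμη
  rw [← withDensity_congr_ae (hf j), Measure.withDensity_rnDeriv_eq _ _ hac]

/-- The common zero set of the densities is null for every `μ j`, hence for their average and for
`η`. -/
theorem ae_exists_ne_zero_of_ac_averageMeasure (hημ : η ≪ averageMeasure μ)
    (hf : ∀ j, Measurable (f j)) (hμ : ∀ j, μ j = η.withDensity fun x => f j x) :
    ∀ᵐ x ∂η, ∃ j, f j x ≠ 0 := by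
  refine hημ (averageMeasure_eq_zero_iff.2 fun j => ?_)
  rw [hμ j]
  change ∀ᵐ x ∂(η.withDensity fun x => (f j x : ℝ≥0∞)), ∃ j, f j x ≠ 0
  rw [ae_withDensity_iff (hf j).coe_nnreal_ennreal]
  exact .of_forall fun x hx => ⟨j, by simpa using hx⟩

end

/-! ### Compactification and return to `X × Y` -/

/-- A measure on a product that has, along embeddings, the weighted marginals `η`, `ν` is
the image of a measure with these weighted marginals. -/
theorem exists_hasWeightedMarginals_map_eq {X Y A B : Type*} [MeasurableSpace X]
    [MeasurableSpace Y] [MeasurableSpace A] [MeasurableSpace B] {d : ℕ} {a : X → A} {b : Y → B}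
    (ha : MeasurableEmbedding a) (hb : MeasurableEmbedding b) {η : Measure X}
    {ν : Fin d → Measure Y} {f : Fin d → A → ℝ≥0} (hf : ∀ j, Measurable (f j))
    (hpos : ∀ᵐ x ∂η, ∃ j, f j (a x) ≠ 0) {ρ : Measure (A × B)}
    (h : HasWeightedMarginals (η.map a) (fun j => (ν j).map b) f ρ) :
    ∃ π : Measure (X × Y), HasWeightedMarginals η ν (fun j x => f j (a x)) π ∧
      π.map (Prod.map a b) = ρ := by
  have he : MeasurableEmbedding (Prod.map a b) := ha.prodMap hb
  have hfst : ∀ {p : A → Prop}, MeasurableSet {x | p x} → (∀ᵐ x ∂η, p (a x)) →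
      ∀ᵐ z ∂ρ, p z.1 := fun hp hx => by
    refine ae_of_ae_map measurable_fst.aemeasurable ?_
    rw [← Measure.fst, h.fst_eq, ha.ae_map_iff]
    exact hx
  have h1 : ∀ᵐ z ∂ρ, z.1 ∈ Set.range a :=
    hfst (p := fun x => x ∈ Set.range a) ha.measurableSet_range (.of_forall fun x => ⟨x, rfl⟩)
  have h2 : ∀ᵐ z ∂ρ, ∃ j, f j z.1 ≠ 0 := by
    refine hfst (p := fun x => ∃ j, f j x ≠ 0) ?_ hpos
    simp only [Set.ofPred_exists]
    exact .iUnion fun j => (hf j) (measurableSet_singleton 0).compl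
  have hm : ∀ j, Measurable fun z : A × B => (f j z.1 : ℝ≥0∞) := fun j =>
    ((hf j).comp measurable_fst).coe_nnreal_ennreal
  -- The marginal of `f j · ρ` controls the second coordinate only where `f j ≠ 0`; `h2` ensures
  -- that some `j` applies.
  have h3 : ∀ j, ∀ᵐ z ∂ρ, f j z.1 ≠ 0 → z.2 ∈ Set.range b := fun j => by
    have : ∀ᵐ z ∂(ρ.withDensity fun z => (f j z.1 : ℝ≥0∞)), z.2 ∈ Set.range b := by
      refine ae_of_ae_map measurable_snd.aemeasurable ?_
      rw [← Measure.snd, h.snd_eq, hb.ae_map_iff]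
      exact .of_forall fun x => ⟨x, rfl⟩
    rw [ae_withDensity_iff (hm j)] at this
    simpa using this
  have hrange : ∀ᵐ z ∂ρ, z ∈ Set.range (Prod.map a b) := by
    filter_upwards [h1, h2, ae_all_iff.2 h3] with z hz1 ⟨j, hj⟩ hz3
    rw [Set.range_prodMap]
    exact ⟨hz1, hz3 j hj⟩
  have hmap : (ρ.comap (Prod.map a b)).map (Prod.map a b) = ρ := by
    rw [he.map_comap, Measure.restrict_eq_self_of_ae_mem hrange]
  refine ⟨ρ.comap (Prod.map a b), ⟨?_, fun j => ?_⟩, hmap⟩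
  · rw [← ha.comap_map (Measure.fst _), ← ha.comap_map η, ← h.fst_eq, ← hmap, Measure.fst,
      Measure.fst, Measure.map_map ha.measurable measurable_fst,
      Measure.map_map measurable_fst he.measurable, hmap]
    rfl
  · rw [← hb.comap_map (Measure.snd _), ← hb.comap_map (ν j), ← h.snd_eq, Measure.snd,
      Measure.snd, Measure.map_map hb.measurable measurable_snd]
    congr 1
    conv_rhs => rw [← hmap]
    rw [← Measure.map_withDensity_comp _ he.measurable (hm j),
      Measure.map_map measurable_snd he.measurable]
    rfl

/-- A second countable metrizable space embeds in a compact metrizable one to which finitely many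
given bounded continuous functions extend. -/
theorem exists_isEmbedding_pi_extending {X : Type*} [TopologicalSpace X]
    [TopologicalSpace.MetrizableSpace X] [SecondCountableTopology X] {d : ℕ}
    (f : Fin d → X →ᵇ ℝ≥0) :
    ∃ (M : Fin d → ℝ≥0) (e : X → (ℕ → unitInterval) × ∀ j, Set.Icc 0 (M j)),
      Topology.IsEmbedding e ∧ ∀ j x, ((e x).2 j : ℝ≥0) = f j x := by
  let _ := TopologicalSpace.metrizableSpaceMetric X
  obtain ⟨F, hF⟩ := Metric.PiNatEmbed.exists_embedding_to_hilbert_cube (X := X)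
  -- The Hilbert cube factor already embeds `X`; the other coordinates record `f j`, so that each
  -- extends as a projection.
  refine ⟨fun j => nndist (f j) 0, fun x => (F x, fun j =>
    ⟨f j x, zero_le, BoundedContinuousFunction.NNReal.upper_bound (f j) x⟩), ?_, fun j x => rfl⟩
  refine Topology.IsEmbedding.of_comp (g := Prod.fst) ?_ continuous_fst hF
  exact hF.continuous.prodMk (continuous_pi fun j => (f j).continuous.subtype_mk _)

section compactification

variable {X Y A B : Type*}
    [TopologicalSpace X] [PolishSpace X] [MeasurableSpace X] [BorelSpace X]
    [TopologicalSpace Y] [PolishSpace Y] [MeasurableSpace Y] [BorelSpace Y]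
    [TopologicalSpace A] [CompactSpace A] [TopologicalSpace.MetrizableSpace A]
    [SecondCountableTopology A] [MeasurableSpace A] [BorelSpace A]
    [TopologicalSpace B] [CompactSpace B] [TopologicalSpace.MetrizableSpace B]
    [SecondCountableTopology B] [MeasurableSpace B] [BorelSpace B] {d : ℕ}

theorem exists_hasWeightedMarginals_lintegral_le_of_isEmbedding [Nonempty X] [Nonempty Y]
    {a : X → A} {b : Y → B} (ha : Topology.IsEmbedding a) (hb : Topology.IsEmbedding b)
    (η : Measure X) [IsProbabilityMeasure η] (ν : Fin d → Measure Y) [∀ j, IsFiniteMeasure (ν j)]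
    (f : Fin d → C(A, ℝ≥0)) (hpos : ∀ᵐ x ∂η, ∃ j, f j (a x) ≠ 0)
    {c : X × Y → ℝ≥0∞} (hc : LowerSemicontinuous c) (T : ℝ)
    (hT : ∀ p ∈ dualFeasible η ν (fun j x => f j (a x)) c, dualValue η ν p ≤ T) :
    ∃ π, HasWeightedMarginals η ν (fun j x => f j (a x)) π ∧
      ∫⁻ z, c z ∂π ≤ ENNReal.ofReal T := by
  have ham := ha.continuous.measurable
  have hbm := hb.continuous.measurable
  obtain ⟨ρ, _, hfst, hsnd, hle⟩ := exists_finiteMeasure_of_dual_bound ham hbm η ν f c T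
    (fun p hp => hT (p.1.comp ⟨a, ha.continuous⟩, fun j => (p.2 j).comp ⟨b, hb.continuous⟩)
      ⟨Integrable.of_bound (p.1.continuous.measurable.comp ham).aestronglyMeasurable ‖p.1‖
        (.of_forall fun x => p.1.norm_coe_le_norm (a x)),
      fun j => Integrable.of_bound ((p.2 j).continuous.measurable.comp hbm).aestronglyMeasurable
        ‖p.2 j‖ (.of_forall fun y => (p.2 j).norm_coe_le_norm (b y)),
      fun x y => EReal.coe_le_coe_ennreal_iff.2 (hp x y)⟩)
  have hfm : ∀ j, Measurable (f j) := fun j => (f j).continuous.measurable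
  have hint : ∀ u : C(A × B, ℝ), Integrable u ρ := fun u =>
    u.continuous.integrable_of_hasCompactSupport (HasCompactSupport.of_compactSpace _)
  have hmarg : HasWeightedMarginals (η.map a) (fun j => (ν j).map b) (fun j => f j) ρ := by
    refine ⟨?_, fun j => ?_⟩
    · refine ext_of_forall_integral_eq_of_IsFiniteMeasure fun φ => ?_
      rw [Measure.fst, integral_map measurable_fst.aemeasurable
        φ.continuous.measurable.aestronglyMeasurable, integral_map ham.aemeasurable
        φ.continuous.measurable.aestronglyMeasurable]
      exact hfst φ
    · have : IsFiniteMeasure (ρ.withDensity fun z => (f j z.1 : ℝ≥0∞)) := by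
        refine isFiniteMeasure_withDensity (ne_of_eq_of_ne (lintegral_coe_eq_integral _ ?_)
          ENNReal.ofReal_ne_top)
        exact hint ⟨fun z => (f j z.1 : ℝ), by fun_prop⟩
      refine ext_of_forall_integral_eq_of_IsFiniteMeasure fun ψ => ?_
      rw [Measure.snd, integral_map measurable_snd.aemeasurable
        ψ.continuous.measurable.aestronglyMeasurable, integral_map hbm.aemeasurable
        ψ.continuous.measurable.aestronglyMeasurable]
      exact (integral_withDensity_eq_integral_smul ((hfm j).comp measurable_fst)
        (fun z => ψ z.2)).trans (hsnd j ψ)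
  obtain ⟨π, hπ, hπρ⟩ := exists_hasWeightedMarginals_map_eq (ham.measurableEmbedding ha.injective)
    (hbm.measurableEmbedding hb.injective) hfm hpos hmarg
  refine ⟨π, hπ, ?_⟩
  obtain ⟨h, hmono, hsup⟩ := hc.exists_monotone_extendable (ha.prodMap hb).isInducing
  have hem : Measurable (Prod.map a b) := ham.prodMap hbm
  have hhm : ∀ n, Measurable (h n) := fun n => (h n).continuous.measurable
  simp only [← hsup]
  rw [lintegral_iSup (f := fun n z => (h n (Prod.map a b z) : ℝ≥0∞))
    (fun n => (hhm n).coe_nnreal_ennreal.comp hem)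
    (fun m n hmn z => ENNReal.coe_le_coe.2 (hmono hmn _))]
  refine iSup_le fun n => ?_
  rw [← lintegral_map (f := fun z => (h n z : ℝ≥0∞)) (hhm n).coe_nnreal_ennreal hem, hπρ]
  let u : C(A × B, ℝ) := ⟨fun z => (h n z : ℝ), by fun_prop⟩
  have hu := hle u (fun x y => by
    rw [← hsup (x, y)]
    refine le_iSup_of_le n ?_
    simp [u])
  rw [lintegral_coe_eq_integral _ (hint u)]
  exact ENNReal.ofReal_le_ofReal hu

end compactification

/-! ### Duality and attainment -/

theorem theorem3p5 {X Y : Type*}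
    [TopologicalSpace X] [PolishSpace X] [MeasurableSpace X] [BorelSpace X]
    [TopologicalSpace Y] [PolishSpace Y] [MeasurableSpace Y] [BorelSpace Y]
    {d : ℕ} (μ : Fin d → Measure X) (ν : Fin d → Measure Y)
    [∀ j, IsFiniteMeasure (μ j)] [∀ j, IsFiniteMeasure (ν j)]
    (hpos : ∀ j, 0 < ν j Set.univ)
    (hbal : ∀ j, μ j Set.univ = ν j Set.univ)
    (η : Measure X) [IsProbabilityMeasure η]
    (hημ : η ≪ averageMeasure μ) (hμη : averageMeasure μ ≪ η)
    (f : Fin d → X →ᵇ ℝ≥0)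
    (hf : ∀ j, (μ j).rnDeriv η =ᵐ[η] fun x => (f j x : ℝ≥0∞))
    (g : X →ᵇ ℝ≥0)
    (hg : η.rnDeriv (averageMeasure μ) =ᵐ[averageMeasure μ] fun x => (g x : ℝ≥0∞))
    (c : X × Y → ℝ≥0∞) (hc : LowerSemicontinuous c) :
    (((⨅ π ∈ transportPlans η μ ν, ∫⁻ z, c z ∂π : ℝ≥0∞) : EReal) =
      ⨆ p ∈ dualFeasible η ν (fun j => f j) c, (dualValue η ν p : EReal)) ∧
    ((transportPlans η μ ν).Nonempty →
      ∃ π ∈ transportPlans η μ ν,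
        ∫⁻ z, c z ∂π = ⨅ π' ∈ transportPlans η μ ν, ∫⁻ z, c z ∂π') := by
  have hfm : ∀ j, Measurable (f j) := fun j => (f j).continuous.measurable
  have hμ := eq_withDensity_of_averageMeasure_ac (f := fun j => f j) hμη hf
  have hexists := ae_exists_ne_zero_of_ac_averageMeasure (f := fun j => f j) hημ hfm hμ
  -- `x₀` makes `X` nonempty; the index `j₀` supplies a nonzero `ν j₀`, which makes `Y` nonempty.
  obtain ⟨x₀, j₀, -⟩ := hexists.exists
  have : Nonempty X := ⟨x₀⟩
  have : Nonempty Y := by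
    by_contra h
    rw [not_nonempty_iff] at h
    have := hpos j₀
    simp [Measure.eq_zero_of_isEmpty] at this
  set P := ⨅ π ∈ transportPlans η μ ν, ∫⁻ z, c z ∂π
  set D := ⨆ p ∈ dualFeasible η ν (fun j => f j) c, (dualValue η ν p : EReal)
  have hweak : D ≤ P := by
    refine iSup₂_le fun p hp => ?_
    have hreal : ENNReal.ofReal (dualValue η ν p) ≤ P := le_iInf₂ fun π hπ =>
      EReal.coe_le_coe_ennreal_iff.1 ((hasWeightedMarginals_of_mem_transportPlans hbal hfm hμ
        hπ).dualValue_le hfm hc.measurable.aemeasurable hp)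
    exact EReal.coe_le_coe_ennreal_iff.2 hreal
  have hD0 : 0 ≤ D := by
    refine le_iSup₂_of_le (0 : C(X, ℝ) × (Fin d → C(Y, ℝ))) ?_ ?_
    · exact ⟨by simp, by simp, fun x y => by simpa using EReal.coe_ennreal_nonneg _⟩
    · simp [dualValue]
  -- `D ≥ 0` excludes `⊥`; if `D = ⊤`, weak duality makes every plan optimal; a finite `D` is the
  -- bound `T` for the compact argument.
  induction hDt : D with
  | bot => simp [hDt] at hD0
  | top =>
    have hP : P = ⊤ := by simpa [hDt] using hweak
    refine ⟨by simp [hP], fun ⟨π, hπ⟩ => ⟨π, hπ, ?_⟩⟩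
    rw [hP, eq_top_iff, ← hP]
    exact iInf₂_le π hπ
  | coe T =>
    obtain ⟨M, a, ha, haf⟩ := exists_isEmbedding_pi_extending f
    let _ := TopologicalSpace.metrizableSpaceMetric Y
    obtain ⟨b, hb⟩ := Metric.PiNatEmbed.exists_embedding_to_hilbert_cube (X := Y)
    let F : ∀ j, C((ℕ → unitInterval) × ∀ j, Set.Icc 0 (M j), ℝ≥0) :=
      fun j => ⟨fun z => (z.2 j : ℝ≥0), by fun_prop⟩
    have hF : (fun j x => F j (a x)) = fun j => ⇑(f j) := by
      ext j x
      simp [F, haf]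
    obtain ⟨π, hπ, hπT⟩ := exists_hasWeightedMarginals_lintegral_le_of_isEmbedding ha hb η ν F
      (by simpa [F, haf] using hexists) hc T (by
        rw [hF]
        intro p hp
        rw [← EReal.coe_le_coe_iff, ← hDt]
        exact le_iSup₂_of_le p hp le_rfl)
    rw [hF] at hπ
    have hmem := hπ.mem_transportPlans hfm hμ
    have hT0 : 0 ≤ T := by simpa [hDt] using hD0
    have hPT : P = ENNReal.ofReal T := le_antisymm ((iInf₂_le π hmem).trans hπT)
      (EReal.coe_le_coe_ennreal_iff.1 (hDt ▸ hweak))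
    refine ⟨by rw [hPT, EReal.coe_ennreal_ofReal, max_eq_left hT0], fun _ => ⟨π, hmem, ?_⟩⟩
    exact le_antisymm (hπT.trans_eq hPT.symm) (iInf₂_le π hmem)
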